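/- Formulas are built from a set of atoms with the connectives $\wedge,\vee,\to,\Box,\bot$. A (single-conclusion) sequent $\Gamma\Rightarrow\Delta$ consists of a finite multiset $\Gamma$ of formulas and a multiset $\Delta$ of at most one formula. A sequent calculus is a set of rules, and it derives the sequents that have a finite derivation tree. Below, $p$ ranges over atoms, lower-case Greek letters over formulas, $\Gamma$ over finite multisets of formulas, and $\Delta$ over multisets of at most one formula; "$S_1;\dots;S_n\,/\,S$" denotes the rule with premises $S_1,\dots,S_n$ and conclusion $S$. $\mathbf{G3iM^w}$ has the axioms $\Gamma,p\Rightarrow p$ and $\Gamma,\bot\Rightarrow\phi$ and the rules - $\Gamma,\phi,\psi\Rightarrow\theta\,/\,\Gamma,\phi\wedge\psi\Rightarrow\theta$; - $\Gamma\Rightarrow\phi;\ \Gamma\Rightarrow\psi\,/\,\Gamma\Rightarrow\phi\wedge\psi$; - $\Gamma,\phi\Rightarrow\theta;\ \Gamma,\psi\Rightarrow\theta\,/\,\Gamma,\phi\vee\psi\Rightarrow\theta$; - $\Gamma\Rightarrow\phi_i\,/\,\Gamma\Rightarrow\phi_0\vee\phi_1$ ($i=0,1$); - $\Gamma,\phi\to\psi\Rightarrow\phi;\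 \Gamma,\psi\Rightarrow\theta\,/\,\Gamma,\phi\to\psi\Rightarrow\theta$; - $\Gamma,\phi\Rightarrow\psi\,/\,\Gamma\Rightarrow\phi\to\psi$; - $\phi\Rightarrow\psi\,/\,\Gamma,\Box\phi\Rightarrow\Box\psi$. The logic $\mathsf{iM}$ is the set of all formulas $\phi$ such that $\mathbf{G3iM^w}$ derives $(\ \Rightarrow\phi)$. $\mathbf{G4iM}$ has the axioms $\Gamma,p\Rightarrow p$ and $\Gamma,\bot\Rightarrow\phi$ and the rules - $\Gamma,\phi,\psi\Rightarrow\Delta\,/\,\Gamma,\phi\wedge\psi\Rightarrow\Delta$; - $\Gamma\Rightarrow\phi;\ \Gamma\Rightarrow\psi\,/\,\Gamma\Rightarrow\phi\wedge\psi$; - $\Gamma,\phi\Rightarrow\Delta;\ \Gamma,\psi\Rightarrow\Delta\,/\,\Gamma,\phi\vee\psi\Rightarrow\Delta$; - $\Gamma\Rightarrow\phi_i\,/\,\Gamma\Rightarrow\phi_0\vee\phi_1$ ($i=0,1$); - $\Gamma,p,\psi\Rightarrow\Delta\,/\,\Gamma,p,p\to\psi\Rightarrow\Delta$; - $\Gamma,\phi_1\to(\phi_2\to\psi)\Rightarrow\Delta\,/\,\Gamma,(\phi_1\wedge\phi_2)\to\psi\Rightarrow\Delta$;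 - $\Gamma,\phi_1\to\psi,\phi_2\to\psi\Rightarrow\Delta\,/\,\Gamma,(\phi_1\vee\phi_2)\to\psi\Rightarrow\Delta$; - $\Gamma,\phi\Rightarrow\psi\,/\,\Gamma\Rightarrow\phi\to\psi$; - $\Gamma,\phi_2\to\psi\Rightarrow\phi_1\to\phi_2;\ \Gamma,\psi\Rightarrow\Delta\,/\,\Gamma,(\phi_1\to\phi_2)\to\psi\Rightarrow\Delta$; - $\Gamma\Rightarrow\Delta\,/\,\Gamma,\phi\Rightarrow\Delta$ and $\Gamma\Rightarrow\ /\,\Gamma\Rightarrow\phi$; - $\phi\Rightarrow\psi\,/\,\Box\phi\Rightarrow\Box\psi$; - $\phi\Rightarrow\psi;\ \Gamma,\Box\phi,\theta\Rightarrow\Delta\,/\,\Gamma,\Box\phi,\Box\psi\to\theta\Rightarrow\Delta$. A calculus is terminating if every sequent is the conclusion of only finitely many rule instances and the relation "$P$ is a premise of a rule instance with conclusion $S$" between sequents is well-founded. A proof search starts with a finite multiset of sequents (the open goals) and in each step replaces some open goal $S$ by the premises of some rule instance with conclusion $S$. Theorem. (1) For every sequent $S$, $\mathbf{G3iM^w}$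 derives $S$ if and only if $\mathbf{G4iM}$ derives $S$. (2) $\mathbf{G4iM}$ is a terminating sequent calculus for $\mathsf{iM}$: it is terminating, and $\mathsf{iM}$ is the set of all formulas $\phi$ such that $\mathbf{G4iM}$ derives $(\ \Rightarrow\phi)$. (3) Every proof search in $\mathbf{G4iM}$ terminates, i.e. there is no infinite proof search. -/

import Mathlib

namespace IMLogic

universe u

/-- Formulas over the language `{∧, ∨, →, □, ⊥}` with atoms from `α`. -/
inductive Formula (α : Type u) : Type u
  | atom : α → Formula α
  | bot : Formula α
  | and : Formula α → Formula α → Formula α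
  | or : Formula α → Formula α → Formula α
  | imp : Formula α → Formula α → Formula α
  | box : Formula α → Formula α

/-- Single-conclusion sequents `Γ ⇒ Δ`: the antecedent is a finite multiset, and the succedent
contains at most one formula (`none` is the empty succedent). -/
structure Sequent (α : Type u) : Type u where
  ant : Multiset (Formula α)
  suc : Option (Formula α)

/-- A sequent calculus, given by the instances of its rules: `C Ps S` says that the premises `Ps`
over the conclusion `S` form an instance of a rule. Axioms are rules without premises. -/
abbrev Calculus (α : Type u) : Type u := List (Sequent α) → Sequent α → Prop

/-- Derivability in a calculus: existence of a finite derivation tree. -/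
inductive Derivable {α : Type u} (C : Calculus α) : Sequent α → Prop
  | rule (Ps : List (Sequent α)) (S : Sequent α) (h : C Ps S)
      (hPs : ∀ P ∈ Ps, Derivable C P) : Derivable C S

open Formula

/-- The calculus `G3iM^w`. -/
inductive G3iMw {α : Type u} : Calculus α
  | ax (Γ : Multiset (Formula α)) (p : α) :
      G3iMw [] ⟨atom p ::ₘ Γ, some (atom p)⟩
  | botL (Γ : Multiset (Formula α)) (φ : Formula α) :
      G3iMw [] ⟨bot ::ₘ Γ, some φ⟩
  | andL (Γ : Multiset (Formula α)) (φ ψ θ : Formula α) :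
      G3iMw [⟨φ ::ₘ ψ ::ₘ Γ, some θ⟩] ⟨and φ ψ ::ₘ Γ, some θ⟩
  | andR (Γ : Multiset (Formula α)) (φ ψ : Formula α) :
      G3iMw [⟨Γ, some φ⟩, ⟨Γ, some ψ⟩] ⟨Γ, some (and φ ψ)⟩
  | orL (Γ : Multiset (Formula α)) (φ ψ θ : Formula α) :
      G3iMw [⟨φ ::ₘ Γ, some θ⟩, ⟨ψ ::ₘ Γ, some θ⟩] ⟨or φ ψ ::ₘ Γ, some θ⟩
  | orR₀ (Γ : Multiset (Formula α)) (φ ψ : Formula α) :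
      G3iMw [⟨Γ, some φ⟩] ⟨Γ, some (or φ ψ)⟩
  | orR₁ (Γ : Multiset (Formula α)) (φ ψ : Formula α) :
      G3iMw [⟨Γ, some ψ⟩] ⟨Γ, some (or φ ψ)⟩
  | impL (Γ : Multiset (Formula α)) (φ ψ θ : Formula α) :
      G3iMw [⟨imp φ ψ ::ₘ Γ, some φ⟩, ⟨ψ ::ₘ Γ, some θ⟩] ⟨imp φ ψ ::ₘ Γ, some θ⟩
  | impR (Γ : Multiset (Formula α)) (φ ψ : Formula α) :
      G3iMw [⟨φ ::ₘ Γ, some ψ⟩] ⟨Γ, some (imp φ ψ)⟩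
  | mono (Γ : Multiset (Formula α)) (φ ψ : Formula α) :
      G3iMw [⟨{φ}, some ψ⟩] ⟨box φ ::ₘ Γ, some (box ψ)⟩

/-- The calculus `G4ip` for intuitionistic propositional logic, over the modal language. -/
inductive G4ip {α : Type u} : Calculus α
  | ax (Γ : Multiset (Formula α)) (p : α) :
      G4ip [] ⟨atom p ::ₘ Γ, some (atom p)⟩
  | botL (Γ : Multiset (Formula α)) (φ : Formula α) :
      G4ip [] ⟨bot ::ₘ Γ, some φ⟩
  | andL (Γ : Multiset (Formula α)) (φ ψ : Formula α) (Δ : Option (Formula α)) :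
      G4ip [⟨φ ::ₘ ψ ::ₘ Γ, Δ⟩] ⟨and φ ψ ::ₘ Γ, Δ⟩
  | andR (Γ : Multiset (Formula α)) (φ ψ : Formula α) :
      G4ip [⟨Γ, some φ⟩, ⟨Γ, some ψ⟩] ⟨Γ, some (and φ ψ)⟩
  | orL (Γ : Multiset (Formula α)) (φ ψ : Formula α) (Δ : Option (Formula α)) :
      G4ip [⟨φ ::ₘ Γ, Δ⟩, ⟨ψ ::ₘ Γ, Δ⟩] ⟨or φ ψ ::ₘ Γ, Δ⟩
  | orR₀ (Γ : Multiset (Formula α)) (φ ψ : Formula α) :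
      G4ip [⟨Γ, some φ⟩] ⟨Γ, some (or φ ψ)⟩
  | orR₁ (Γ : Multiset (Formula α)) (φ ψ : Formula α) :
      G4ip [⟨Γ, some ψ⟩] ⟨Γ, some (or φ ψ)⟩
  | atomImpL (Γ : Multiset (Formula α)) (p : α) (ψ : Formula α) (Δ : Option (Formula α)) :
      G4ip [⟨atom p ::ₘ ψ ::ₘ Γ, Δ⟩] ⟨atom p ::ₘ imp (atom p) ψ ::ₘ Γ, Δ⟩
  | andImpL (Γ : Multiset (Formula α)) (φ₁ φ₂ ψ : Formula α) (Δ : Option (Formula α)) :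
      G4ip [⟨imp φ₁ (imp φ₂ ψ) ::ₘ Γ, Δ⟩] ⟨imp (and φ₁ φ₂) ψ ::ₘ Γ, Δ⟩
  | orImpL (Γ : Multiset (Formula α)) (φ₁ φ₂ ψ : Formula α) (Δ : Option (Formula α)) :
      G4ip [⟨imp φ₁ ψ ::ₘ imp φ₂ ψ ::ₘ Γ, Δ⟩] ⟨imp (or φ₁ φ₂) ψ ::ₘ Γ, Δ⟩
  | impR (Γ : Multiset (Formula α)) (φ ψ : Formula α) :
      G4ip [⟨φ ::ₘ Γ, some ψ⟩] ⟨Γ, some (imp φ ψ)⟩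
  | impImpL (Γ : Multiset (Formula α)) (φ₁ φ₂ ψ : Formula α) (Δ : Option (Formula α)) :
      G4ip [⟨imp φ₂ ψ ::ₘ Γ, some (imp φ₁ φ₂)⟩, ⟨ψ ::ₘ Γ, Δ⟩]
        ⟨imp (imp φ₁ φ₂) ψ ::ₘ Γ, Δ⟩

/-- The calculus `G4w`: `G4ip` with the left and right weakening rules. -/
inductive G4w {α : Type u} : Calculus α
  | ofG4ip (Ps : List (Sequent α)) (S : Sequent α) (h : G4ip Ps S) : G4w Ps S
  | weakL (Γ : Multiset (Formula α)) (φ : Formula α) (Δ : Option (Formula α)) :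
      G4w [⟨Γ, Δ⟩] ⟨φ ::ₘ Γ, Δ⟩
  | weakR (Γ : Multiset (Formula α)) (φ : Formula α) :
      G4w [⟨Γ, none⟩] ⟨Γ, some φ⟩

/-- The calculus `G4iM`: `G4w` with the rules `M` and `LM→`. -/
inductive G4iM {α : Type u} : Calculus α
  | ofG4w (Ps : List (Sequent α)) (S : Sequent α) (h : G4w Ps S) : G4iM Ps S
  | mono (φ ψ : Formula α) :
      G4iM [⟨{φ}, some ψ⟩] ⟨{box φ}, some (box ψ)⟩
  | boxImpL (Γ : Multiset (Formula α)) (φ ψ θ : Formula α) (Δ : Option (Formula α)) :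
      G4iM [⟨{φ}, some ψ⟩, ⟨box φ ::ₘ θ ::ₘ Γ, Δ⟩] ⟨box φ ::ₘ imp (box ψ) θ ::ₘ Γ, Δ⟩

/-- The logic of a calculus: the formulas `φ` for which `⇒ φ` is derivable. -/
def logicOf {α : Type u} (C : Calculus α) : Set (Formula α) :=
  {φ | Derivable C ⟨0, some φ⟩}

/-- Intuitionistic monotone modal logic, defined as the logic of `G3iM^w`. -/
def iM (α : Type u) : Set (Formula α) := logicOf G3iMw

/-- A calculus is terminating if every sequent is the conclusion of only finitely many rule
instances, and the relation "is a premise of a rule instance with conclusion" is well-founded. -/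
structure IsTerminating {α : Type u} (C : Calculus α) : Prop where
  finite_instances : ∀ S : Sequent α, {Ps : List (Sequent α) | C Ps S}.Finite
  premise_wf : WellFounded (fun P S : Sequent α => ∃ Ps, C Ps S ∧ P ∈ Ps)

/-- One step of proof search on a multiset `G` of open goals: an arbitrary open goal `S` is
replaced by the premises of an arbitrary rule instance with conclusion `S`, which gives `G'`. -/
def SearchStep {α : Type u} (C : Calculus α) (G G' : Multiset (Sequent α)) : Prop :=
  ∃ (S : Sequent α) (Ps : List (Sequent α)) (H : Multiset (Sequent α)),
    C Ps S ∧ G = S ::ₘ H ∧ G' = (Ps : Multiset (Sequent α)) + H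

end IMLogic

namespace IMLogic

universe v

open Formula

variable {α : Type v}

/-! Termination: with cost `3 ^ weight` summed over a sequent, every premise in `G4iM` is cheaper
than its conclusion. Only finitely many instances fit a given conclusion, and an infinite search
would contradict well-foundedness of the induced order on multisets of goals.

Equivalence: both calculi derive exactly the sequents valid in one model, so no cut elimination is
carried out on derivations. Formulas are interpreted as closed sets of contexts, closure being
defined through cut-free derivability in a set-based variant of `G3iM^w`. By
`Formula.mem_val_and_setDerivable`, a context containing `φ` lies in the value of `φ`, and a context
in that value derives `φ`. Hence validity yields a cut-free set derivation, which
`SetDerivable.toG3` turns into one of `G3iM^w`. Soundness is checked rule by rule.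

Completeness of `G4iM` is by induction on cost: for a valid sequent some rule instance has valid
premises. If no invertible left rule from a short list applies, a cut-free set derivation of the
sequent points to the instance; the delicate case, a left implication, is
`Entails.derivable_of_imp_mem`. -/

/-! ### Termination -/

/-- Dyckhoff's weight of a formula. -/
def Formula.weight : Formula α → ℕ
  | atom _ => 1
  | bot => 1
  | Formula.and φ ψ => φ.weight + ψ.weight + 2
  | Formula.or φ ψ => φ.weight + ψ.weight + 1
  | imp φ ψ => φ.weight + ψ.weight + 1
  | box φ => φ.weight + 1

theorem Formula.weight_pos (φ : Formula α) : 0 < φ.weight := by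
  cases φ <;> simp [Formula.weight]

/-- An exponential cost, for which one formula outweighs any two formulas of smaller weight. -/
def Formula.cost (φ : Formula α) : ℕ := 3 ^ φ.weight

theorem Formula.cost_pos (φ : Formula α) : 0 < φ.cost := by
  unfold Formula.cost; positivity

/-- Base 3 makes this strict, since `2 * 3 ^ n < 3 ^ (n + 1)`; base 2 would give only `≤`. -/
theorem Formula.cost_add_lt {φ ψ χ : Formula α} (h₁ : φ.weight < χ.weight)
    (h₂ : ψ.weight < χ.weight) : φ.cost + ψ.cost < χ.cost := by
  obtain ⟨n, hn⟩ : ∃ n, χ.weight = n + 1 := ⟨χ.weight - 1, by omega⟩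
  have a : φ.cost ≤ 3 ^ n := Nat.pow_le_pow_right (by norm_num) (by omega)
  have b : ψ.cost ≤ 3 ^ n := Nat.pow_le_pow_right (by norm_num) (by omega)
  have c : χ.cost = 3 ^ n * 3 := by rw [Formula.cost, hn, pow_succ]
  have d : 0 < 3 ^ n := by positivity
  omega

/-- The total cost of the formulas in a sequent. -/
def Sequent.cost (S : Sequent α) : ℕ :=
  (S.ant.map Formula.cost).sum + S.suc.elim 0 Formula.cost

/-- In a premise, a logical or modal rule trades a principal formula for at most two formulas of
smaller weight, so `cost_add_lt` applies, with a repeated or dummy summand when there is only one.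
The extra unit in the weight of `∧` makes `φ₁ → (φ₂ → ψ)` lighter than `(φ₁ ∧ φ₂) → ψ`. Weakening
removes a positive cost. -/
theorem G4iM.cost_lt {Ps : List (Sequent α)} {S : Sequent α} (h : G4iM Ps S) :
    ∀ P ∈ Ps, P.cost < S.cost := by
  rcases h with ⟨_, _, ⟨_, _, h⟩ | ⟨Γ, φ, Δ⟩ | ⟨Γ, φ⟩⟩ | ⟨φ, ψ⟩ | ⟨Γ, φ, ψ, θ, Δ⟩
  · cases h with
    | ax => simp
    | botL => simp
    | andL Γ φ ψ Δ =>
      have := cost_add_lt (φ := φ) (ψ := ψ) (χ := Formula.and φ ψ)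
        (by simp only [weight]; omega) (by simp only [weight]; omega)
      simp [Sequent.cost]; omega
    | andR Γ φ ψ =>
      have := cost_add_lt (φ := φ) (ψ := ψ) (χ := Formula.and φ ψ)
        (by simp only [weight]; omega) (by simp only [weight]; omega)
      simp [Sequent.cost]; omega
    | orL Γ φ ψ Δ =>
      have := cost_add_lt (φ := φ) (ψ := ψ) (χ := Formula.or φ ψ)
        (by simp only [weight]; omega) (by simp only [weight]; omega)
      simp [Sequent.cost]; omega
    | orR₀ Γ φ ψ =>
      have := cost_add_lt (φ := φ) (ψ := ψ) (χ := Formula.or φ ψ)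
        (by simp only [weight]; omega) (by simp only [weight]; omega)
      simp [Sequent.cost]; omega
    | orR₁ Γ φ ψ =>
      have := cost_add_lt (φ := φ) (ψ := ψ) (χ := Formula.or φ ψ)
        (by simp only [weight]; omega) (by simp only [weight]; omega)
      simp [Sequent.cost]; omega
    | atomImpL Γ p ψ Δ =>
      have := cost_add_lt (φ := ψ) (ψ := ψ) (χ := imp (atom p) ψ)
        (by simp only [weight]; omega) (by simp only [weight]; omega)
      simp [Sequent.cost]; omega
    | andImpL Γ φ₁ φ₂ ψ Δ =>
      have := cost_add_lt (φ := imp φ₁ (imp φ₂ ψ)) (ψ := ψ) (χ := imp (Formula.and φ₁ φ₂) ψ)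
        (by simp only [weight]; omega) (by simp only [weight]; omega)
      simp [Sequent.cost]; omega
    | orImpL Γ φ₁ φ₂ ψ Δ =>
      have := φ₁.weight_pos
      have := φ₂.weight_pos
      have := cost_add_lt (φ := imp φ₁ ψ) (ψ := imp φ₂ ψ) (χ := imp (Formula.or φ₁ φ₂) ψ)
        (by simp only [weight]; omega) (by simp only [weight]; omega)
      simp [Sequent.cost]; omega
    | impR Γ φ ψ =>
      have := cost_add_lt (φ := φ) (ψ := ψ) (χ := imp φ ψ)
        (by simp only [weight]; omega) (by simp only [weight]; omega)
      simp [Sequent.cost]; omega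
    | impImpL Γ φ₁ φ₂ ψ Δ =>
      have := φ₁.weight_pos
      have := ψ.weight_pos
      have := cost_add_lt (φ := imp φ₂ ψ) (ψ := imp φ₁ φ₂) (χ := imp (imp φ₁ φ₂) ψ)
        (by simp only [weight]; omega) (by simp only [weight]; omega)
      have := cost_add_lt (φ := ψ) (ψ := ψ) (χ := imp (imp φ₁ φ₂) ψ)
        (by simp only [weight]; omega) (by simp only [weight]; omega)
      simp [Sequent.cost]; omega
  · have := φ.cost_pos
    simp [Sequent.cost]; omega
  · have := φ.cost_pos
    simp [Sequent.cost]; omega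
  · have := cost_add_lt (φ := φ) (ψ := φ) (χ := box φ)
      (by simp only [weight]; omega) (by simp only [weight]; omega)
    have := cost_add_lt (φ := ψ) (ψ := ψ) (χ := box ψ)
      (by simp only [weight]; omega) (by simp only [weight]; omega)
    simp [Sequent.cost]; omega
  · have := cost_add_lt (φ := φ) (ψ := φ) (χ := box φ)
      (by simp only [weight]; omega) (by simp only [weight]; omega)
    have := cost_add_lt (φ := ψ) (ψ := θ) (χ := imp (box ψ) θ)
      (by simp only [weight]; omega) (by simp only [weight]; omega)
    simp [Sequent.cost]; omega

theorem G4iM.premise_wellFounded :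
    WellFounded (fun P S : Sequent α => ∃ Ps, G4iM Ps S ∧ P ∈ Ps) :=
  Subrelation.wf (fun ⟨_, h, hP⟩ => h.cost_lt _ hP) (measure Sequent.cost).wf

open Classical in
/-- The premises of the `G4iM` instances with left principal formula `f` and, for the two rules
with a second principal formula, with `g` as that formula. -/
noncomputable def leftCandidates (S : Sequent α) (f g : Formula α) : List (List (Sequent α)) :=
  let Γ := S.ant.erase f
  -- Left weakening, available for every `f`.
  [⟨Γ, S.suc⟩] ::
  match f with
  | Formula.and φ ψ => [[⟨φ ::ₘ ψ ::ₘ Γ, S.suc⟩]]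
  | Formula.or φ ψ => [[⟨φ ::ₘ Γ, S.suc⟩, ⟨ψ ::ₘ Γ, S.suc⟩]]
  | imp (atom p) ψ => [[⟨atom p ::ₘ ψ ::ₘ Γ.erase (atom p), S.suc⟩]]
  | imp (Formula.and φ₁ φ₂) ψ => [[⟨imp φ₁ (imp φ₂ ψ) ::ₘ Γ, S.suc⟩]]
  | imp (Formula.or φ₁ φ₂) ψ => [[⟨imp φ₁ ψ ::ₘ imp φ₂ ψ ::ₘ Γ, S.suc⟩]]
  | imp (imp φ₁ φ₂) ψ => [[⟨imp φ₂ ψ ::ₘ Γ, some (imp φ₁ φ₂)⟩, ⟨ψ ::ₘ Γ, S.suc⟩]]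
  | imp (box ψ) θ =>
    match g with
    | box φ => [[⟨{φ}, some ψ⟩, ⟨box φ ::ₘ θ ::ₘ Γ.erase (box φ), S.suc⟩]]
    | _ => []
  | box φ =>
    match S.suc with
    | some (box ψ) => [[⟨{φ}, some ψ⟩]]
    | _ => []
  | _ => []

/-- The premises of the `G4iM` instances with conclusion `S` and no left principal formula. -/
def rightCandidates (S : Sequent α) : List (List (Sequent α)) :=
  -- The axioms and right weakening, listed whether or not they apply to `S`.
  [] :: [⟨S.ant, none⟩] ::
  match S.suc with
  | some (Formula.and φ ψ) => [[⟨S.ant, some φ⟩, ⟨S.ant, some ψ⟩]]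
  | some (Formula.or φ ψ) => [[⟨S.ant, some φ⟩], [⟨S.ant, some ψ⟩]]
  | some (imp φ ψ) => [[⟨φ ::ₘ S.ant, some ψ⟩]]
  | _ => []

/-- Finiteness needs only this inclusion; a candidate need not be an instance. -/
theorem G4iM.mem_candidates {Ps : List (Sequent α)} {S : Sequent α} (h : G4iM Ps S) :
    Ps ∈ rightCandidates S ∨ ∃ f ∈ S.ant, ∃ g ∈ S.ant, Ps ∈ leftCandidates S f g := by
  classical
  rcases h with ⟨_, _, ⟨_, _, h⟩ | ⟨Γ, φ, Δ⟩ | ⟨Γ, φ⟩⟩ | ⟨φ, ψ⟩ | ⟨Γ, φ, ψ, θ, Δ⟩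
  · cases h with
    | ax => left; simp [rightCandidates]
    | botL => left; simp [rightCandidates]
    | andR => left; simp [rightCandidates]
    | orR₀ => left; simp [rightCandidates]
    | orR₁ => left; simp [rightCandidates]
    | impR => left; simp [rightCandidates]
    | atomImpL Γ p ψ Δ =>
      right
      refine ⟨imp (atom p) ψ, by simp, imp (atom p) ψ, by simp, ?_⟩
      have : (atom p ::ₘ imp (atom p) ψ ::ₘ Γ).erase (imp (atom p) ψ) = atom p ::ₘ Γ := by
        rw [Multiset.cons_swap, Multiset.erase_cons_head]
      simp [leftCandidates, this]
    | _ =>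
      right
      exact ⟨_, Multiset.mem_cons_self _ _, _, Multiset.mem_cons_self _ _,
        by simp [leftCandidates]⟩
  · right
    exact ⟨_, Multiset.mem_cons_self _ _, _, Multiset.mem_cons_self _ _, by simp [leftCandidates]⟩
  · left; simp [rightCandidates]
  · right
    exact ⟨box φ, by simp, box φ, by simp, by simp [leftCandidates]⟩
  · right
    refine ⟨imp (box ψ) θ, by simp, box φ, by simp, ?_⟩
    have : (box φ ::ₘ imp (box ψ) θ ::ₘ Γ).erase (imp (box ψ) θ) = box φ ::ₘ Γ := by
      rw [Multiset.cons_swap, Multiset.erase_cons_head]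
    simp [leftCandidates, this]

theorem G4iM.finite_instances (S : Sequent α) : {Ps : List (Sequent α) | G4iM Ps S}.Finite := by
  classical
  have hfin : {Ps | Ps ∈ rightCandidates S}.Finite := List.finite_toSet _
  have hant : {f | f ∈ S.ant}.Finite := Multiset.finite_toSet _
  refine (hfin.union (hant.biUnion fun f _ => hant.biUnion fun g _ =>
    List.finite_toSet (leftCandidates S f g))).subset ?_
  intro Ps h
  rcases h.mem_candidates with h | ⟨f, hf, g, hg, h⟩
  · exact Or.inl h
  · exact Or.inr (Set.mem_biUnion hf (Set.mem_biUnion hg h))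

theorem G4iM.isTerminating : IsTerminating (G4iM (α := α)) :=
  ⟨finite_instances, premise_wellFounded⟩

/-- In a terminating calculus there is no infinite proof search. -/
theorem IsTerminating.no_infinite_search {C : Calculus α} (hC : IsTerminating C) :
    ¬ ∃ G : ℕ → Multiset (Sequent α), ∀ n, SearchStep C (G n) (G (n + 1)) := by
  rintro ⟨G, hG⟩
  -- A search step is a move of the hydra game: one element of a multiset is replaced by finitely
  -- many smaller ones. `cutExpand` says that such moves are well-founded.
  refine (wellFounded_iff_isEmpty_descending_chain.1 hC.premise_wf.cutExpand).false ⟨G, fun n => ?_⟩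
  obtain ⟨S, Ps, H, h, h₁, h₂⟩ := hG n
  refine ⟨Ps, S, fun P hP => ⟨Ps, h, by simpa using hP⟩, ?_⟩
  rw [h₁, h₂, ← Multiset.singleton_add]
  abel

/-! ### A calculus on sets of formulas -/

/-- A variant of `G3iM^w` whose antecedents are sets, so that principal formulas are kept and
weakening and contraction are built in. -/
inductive SetDerivable : Set (Formula α) → Formula α → Prop
  | ax {Γ p} : atom p ∈ Γ → SetDerivable Γ (atom p)
  | botL {Γ θ} : bot ∈ Γ → SetDerivable Γ θ
  | andL {Γ φ ψ θ} : Formula.and φ ψ ∈ Γ → SetDerivable (insert φ (insert ψ Γ)) θ → SetDerivable Γ θ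
  | andR {Γ φ ψ} : SetDerivable Γ φ → SetDerivable Γ ψ → SetDerivable Γ (Formula.and φ ψ)
  | orL {Γ φ ψ θ} : Formula.or φ ψ ∈ Γ → SetDerivable (insert φ Γ) θ → SetDerivable (insert ψ Γ) θ →
      SetDerivable Γ θ
  | orR₀ {Γ φ ψ} : SetDerivable Γ φ → SetDerivable Γ (Formula.or φ ψ)
  | orR₁ {Γ φ ψ} : SetDerivable Γ ψ → SetDerivable Γ (Formula.or φ ψ)
  | impL {Γ φ ψ θ} : imp φ ψ ∈ Γ → SetDerivable Γ φ → SetDerivable (insert ψ Γ) θ →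
      SetDerivable Γ θ
  | impR {Γ φ ψ} : SetDerivable (insert φ Γ) ψ → SetDerivable Γ (imp φ ψ)
  | mono {Γ φ ψ} : box φ ∈ Γ → SetDerivable {φ} ψ → SetDerivable Γ (box ψ)

theorem SetDerivable.weaken {Γ Γ' : Set (Formula α)} {θ : Formula α} (h : SetDerivable Γ θ)
    (hΓ : Γ ⊆ Γ') : SetDerivable Γ' θ := by
  induction h generalizing Γ' with
  | ax h => exact .ax (hΓ h)
  | botL h => exact .botL (hΓ h)
  | andL h _ ih =>
    exact .andL (hΓ h) (ih (Set.insert_subset_insert (Set.insert_subset_insert hΓ)))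
  | andR _ _ ih₁ ih₂ => exact .andR (ih₁ hΓ) (ih₂ hΓ)
  | orL h _ _ ih₁ ih₂ =>
    exact .orL (hΓ h) (ih₁ (Set.insert_subset_insert hΓ)) (ih₂ (Set.insert_subset_insert hΓ))
  | orR₀ _ ih => exact .orR₀ (ih hΓ)
  | orR₁ _ ih => exact .orR₁ (ih hΓ)
  | impL h _ _ ih₁ ih₂ => exact .impL (hΓ h) (ih₁ hΓ) (ih₂ (Set.insert_subset_insert hΓ))
  | impR _ ih => exact .impR (ih (Set.insert_subset_insert hΓ))
  | mono h h' _ => exact .mono (hΓ h) h'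

/-- `Realizes Γ φ`: the formula `φ` occurs in `Γ`, or has been decomposed in `Γ` by left rules. -/
inductive Realizes (Γ : Multiset (Formula α)) : Formula α → Prop
  | mem {φ} : φ ∈ Γ → Realizes Γ φ
  | and {φ ψ} : Realizes Γ φ → Realizes Γ ψ → Realizes Γ (Formula.and φ ψ)
  | or_left {φ ψ} : Realizes Γ φ → Realizes Γ (Formula.or φ ψ)
  | or_right {φ ψ} : Realizes Γ ψ → Realizes Γ (Formula.or φ ψ)
  | imp {φ ψ} : Realizes Γ ψ → Realizes Γ (imp φ ψ)

theorem Realizes.trans {Γ Γ' : Multiset (Formula α)} {φ : Formula α} (h : Realizes Γ φ)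
    (hΓ : ∀ χ ∈ Γ, Realizes Γ' χ) : Realizes Γ' φ := by
  induction h with
  | mem h => exact hΓ _ h
  | and _ _ h₁ h₂ => exact .and h₁ h₂
  | or_left _ h => exact .or_left h
  | or_right _ h => exact .or_right h
  | imp _ h => exact .imp h

theorem Realizes.cons {Γ : Multiset (Formula α)} {φ : Formula α} (χ : Formula α)
    (h : Realizes Γ φ) : Realizes (χ ::ₘ Γ) φ :=
  h.trans fun _ hχ => .mem (Multiset.mem_cons_of_mem hχ)

/-- A principal formula that is realized by what replaces it can be removed. -/
theorem Realizes.replace {Γ Γ' : Multiset (Formula α)} {φ χ : Formula α}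
    (h : Realizes (χ ::ₘ Γ) φ) (hχ : Realizes Γ' χ) (hΓ : Γ ≤ Γ') : Realizes Γ' φ := by
  refine h.trans fun ξ hξ => ?_
  rcases Multiset.mem_cons.1 hξ with rfl | hξ
  · exact hχ
  · exact .mem (Multiset.mem_of_le hΓ hξ)

/-- The set calculus keeps principal formulas while `G3iM^w` mostly consumes them; `Realizes`
bridges the gap and takes the place of contraction and inversion. If the principal formula occurs in
`Γ`, the rule is applied and the formula stays realized by its components. If it is already
decomposed, the rule is skipped in favour of a premise whose new formulas are realized. Atoms, `⊥`
and boxed formulas are realized only by occurring. -/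
theorem SetDerivable.toG3 {Δ : Set (Formula α)} {θ : Formula α} (h : SetDerivable Δ θ)
    {Γ : Multiset (Formula α)} (hΓ : ∀ φ ∈ Δ, Realizes Γ φ) :
    Derivable G3iMw ⟨Γ, some θ⟩ := by
  induction h generalizing Γ with
  | ax h =>
    cases hΓ _ h with
    | mem h =>
      obtain ⟨Γ', rfl⟩ := Multiset.exists_cons_of_mem h
      exact .rule _ _ (.ax _ _) (by simp)
  | botL h =>
    cases hΓ _ h with
    | mem h =>
      obtain ⟨Γ', rfl⟩ := Multiset.exists_cons_of_mem h
      exact .rule _ _ (.botL _ _) (by simp)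
  | @andL _ φ ψ θ h _ ih =>
    cases hΓ _ h with
    | mem h =>
      obtain ⟨Γ', rfl⟩ := Multiset.exists_cons_of_mem h
      refine .rule _ _ (.andL _ _ _ _) ?_
      simp only [List.mem_singleton, forall_eq]
      have hφ : Realizes (φ ::ₘ ψ ::ₘ Γ') φ := .mem (by simp)
      have hψ : Realizes (φ ::ₘ ψ ::ₘ Γ') ψ := .mem (by simp)
      apply ih
      rintro χ (rfl | rfl | hχ)
      · exact hφ
      · exact hψ
      · exact (hΓ _ hχ).replace (.and hφ hψ)
          ((Multiset.le_cons_self _ _).trans (Multiset.le_cons_self _ _))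
    | and h₁ h₂ =>
      apply ih
      rintro χ (rfl | rfl | hχ)
      · exact h₁
      · exact h₂
      · exact hΓ _ hχ
  | andR _ _ ih₁ ih₂ =>
    refine .rule _ _ (.andR _ _ _) ?_
    simpa using ⟨ih₁ hΓ, ih₂ hΓ⟩
  | @orL _ φ ψ θ h _ _ ih₁ ih₂ =>
    cases hΓ _ h with
    | mem h =>
      obtain ⟨Γ', rfl⟩ := Multiset.exists_cons_of_mem h
      refine .rule _ _ (.orL _ _ _ _) ?_
      have hφ : Realizes (φ ::ₘ Γ') φ := .mem (by simp)
      have hψ : Realizes (ψ ::ₘ Γ') ψ := .mem (by simp)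
      simp only [List.mem_cons, List.not_mem_nil, or_false, forall_eq_or_imp, forall_eq]
      constructor
      · apply ih₁
        rintro χ (rfl | hχ)
        · exact hφ
        · exact (hΓ _ hχ).replace (.or_left hφ) (Multiset.le_cons_self _ _)
      · apply ih₂
        rintro χ (rfl | hχ)
        · exact hψ
        · exact (hΓ _ hχ).replace (.or_right hψ) (Multiset.le_cons_self _ _)
    | or_left h =>
      apply ih₁
      rintro χ (rfl | hχ)
      · exact h
      · exact hΓ _ hχ
    | or_right h =>
      apply ih₂
      rintro χ (rfl | hχ)
      · exact h
      · exact hΓ _ hχ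
  | orR₀ _ ih =>
    refine .rule _ _ (.orR₀ _ _ _) ?_
    simpa using ih hΓ
  | orR₁ _ ih =>
    refine .rule _ _ (.orR₁ _ _ _) ?_
    simpa using ih hΓ
  | @impL _ φ ψ θ h _ _ ih₁ ih₂ =>
    cases hΓ _ h with
    | mem h =>
      obtain ⟨Γ', rfl⟩ := Multiset.exists_cons_of_mem h
      refine .rule _ _ (.impL _ _ _ _) ?_
      have hψ : Realizes (ψ ::ₘ Γ') ψ := .mem (by simp)
      simp only [List.mem_cons, List.not_mem_nil, or_false, forall_eq_or_imp, forall_eq]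
      -- The left premise keeps the implication, so its antecedent is the same multiset.
      refine ⟨ih₁ hΓ, ?_⟩
      apply ih₂
      rintro χ (rfl | hχ)
      · exact hψ
      · exact (hΓ _ hχ).replace (.imp hψ) (Multiset.le_cons_self _ _)
    | imp h =>
      apply ih₂
      rintro χ (rfl | hχ)
      · exact h
      · exact hΓ _ hχ
  | impR _ ih =>
    refine .rule _ _ (.impR _ _ _) ?_
    simp only [List.mem_singleton, forall_eq]
    apply ih
    rintro χ (rfl | hχ)
    · exact .mem (by simp)
    · exact (hΓ _ hχ).cons _
  | mono h _ ih =>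
    cases hΓ _ h with
    | mem h =>
      obtain ⟨Γ', rfl⟩ := Multiset.exists_cons_of_mem h
      refine .rule _ _ (.mono _ _ _) ?_
      simp only [List.mem_singleton, forall_eq]
      apply ih
      rintro χ rfl
      exact .mem (by simp)

/-! ### The model of contexts -/

/-- The least set of contexts that contains `X` and is an intersection of sets of the form
`{Γ | Γ ∪ T ⊢ θ}`. -/
def contextClosure (X : Set (Set (Formula α))) : Set (Set (Formula α)) :=
  {Γ | ∀ T θ, (∀ R ∈ X, SetDerivable (R ∪ T) θ) → SetDerivable (Γ ∪ T) θ}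

theorem subset_contextClosure (X : Set (Set (Formula α))) : X ⊆ contextClosure X :=
  fun _ hΓ _ _ h => h _ hΓ

theorem contextClosure_mono {X Y : Set (Set (Formula α))} (h : X ⊆ Y) :
    contextClosure X ⊆ contextClosure Y :=
  fun _ hΓ T θ hY => hΓ T θ fun R hR => hY R (h hR)

/-- A set of contexts that equals its closure. -/
def ContextClosed (X : Set (Set (Formula α))) : Prop := contextClosure X ⊆ X

theorem contextClosed_contextClosure (X : Set (Set (Formula α))) :
    ContextClosed (contextClosure X) :=
  fun _ hΓ T θ h => hΓ T θ fun _ hR => hR T θ h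

theorem contextClosed_setDerivable (θ : Formula α) : ContextClosed {Γ | SetDerivable Γ θ} := by
  intro Γ hΓ
  simpa using hΓ ∅ θ (fun R hR => by simpa using hR)

theorem ContextClosed.inter {X Y : Set (Set (Formula α))} (hX : ContextClosed X)
    (hY : ContextClosed Y) : ContextClosed (X ∩ Y) :=
  fun _ hΓ => ⟨hX (contextClosure_mono Set.inter_subset_left hΓ),
    hY (contextClosure_mono Set.inter_subset_right hΓ)⟩

theorem ContextClosed.upward {X : Set (Set (Formula α))} (hX : ContextClosed X)
    {Γ Γ' : Set (Formula α)} (h : Γ ∈ X) (hΓ : Γ ⊆ Γ') : Γ' ∈ X :=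
  hX fun _ _ hT => (hT Γ h).weaken (Set.union_subset_union_left _ hΓ)

/-- The interpretation of formulas as closed sets of contexts. -/
def Formula.val : Formula α → Set (Set (Formula α))
  | atom p => {Γ | SetDerivable Γ (atom p)}
  | bot => contextClosure ∅
  | Formula.and φ ψ => φ.val ∩ ψ.val
  | Formula.or φ ψ => contextClosure (φ.val ∪ ψ.val)
  | imp φ ψ => {Γ | ∀ Γ', Γ ⊆ Γ' → Γ' ∈ φ.val → Γ' ∈ ψ.val}
  -- The singleton `{χ}` mirrors the rule for `□`, whose premise keeps one unboxed formula and no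
  -- context.
  | box φ => contextClosure {Γ | ∃ χ, box χ ∈ Γ ∧ {χ} ∈ φ.val}

theorem Formula.contextClosed_val (φ : Formula α) : ContextClosed φ.val := by
  induction φ with
  | atom p => exact contextClosed_setDerivable _
  | bot => exact contextClosed_contextClosure _
  | and φ ψ ihφ ihψ => exact ihφ.inter ihψ
  | or φ ψ => exact contextClosed_contextClosure _
  | box φ => exact contextClosed_contextClosure _
  | imp φ ψ ihφ ihψ =>
    intro Γ hΓ Γ' hΓΓ' hΓ'
    refine ihψ fun T θ hT => ?_
    -- A test `(T, θ)` of `Γ'` against `ψ` becomes the test `(Γ' ∪ T, θ)` of `Γ` against the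
    -- implication, as `Γ ⊆ Γ'`.
    have := hΓ (Γ' ∪ T) θ fun R hR => by
      have hRΓ' : R ∪ Γ' ∈ ψ.val := hR _ Set.subset_union_left
        (ihφ.upward hΓ' Set.subset_union_right)
      simpa [Set.union_assoc] using hT _ hRΓ'
    rwa [← Set.union_assoc, Set.union_eq_right.2 hΓΓ'] at this

theorem Formula.val_bot_subset (φ : Formula α) : (bot : Formula α).val ⊆ φ.val :=
  fun _ hΓ => φ.contextClosed_val (contextClosure_mono (Set.empty_subset _) hΓ)

theorem Formula.val_or_elim {φ ψ θ : Formula α} {Γ : Set (Formula α)} (h : Γ ∈ (Formula.or φ ψ).val)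
    (h₁ : Γ ∈ (imp φ θ).val) (h₂ : Γ ∈ (imp ψ θ).val) : Γ ∈ θ.val := by
  refine θ.contextClosed_val fun T χ hT => ?_
  have := h (Γ ∪ T) χ fun R hR => by
    have hRΓ : R ∪ Γ ∈ θ.val := by
      rcases hR with hR | hR
      · exact h₁ _ Set.subset_union_right (φ.contextClosed_val.upward hR Set.subset_union_left)
      · exact h₂ _ Set.subset_union_right (ψ.contextClosed_val.upward hR Set.subset_union_left)
    simpa [Set.union_assoc] using hT _ hRΓ
  simpa [← Set.union_assoc] using this

theorem Formula.val_box_mono {φ ψ : Formula α} (h : φ.val ⊆ ψ.val) : (box φ).val ⊆ (box ψ).val :=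
  contextClosure_mono fun _ ⟨χ, hχ, hφ⟩ => ⟨χ, hχ, h hφ⟩

/-- Left rules give the first half, right rules the second. The halves are proved together because
at `φ → ψ` each one uses the opposite half for `φ`. -/
theorem Formula.mem_val_and_setDerivable (φ : Formula α) :
    (∀ Γ, φ ∈ Γ → Γ ∈ φ.val) ∧ ∀ Γ ∈ φ.val, SetDerivable Γ φ := by
  induction φ with
  | atom p => exact ⟨fun Γ h => .ax h, fun Γ h => h⟩
  | bot => exact ⟨fun Γ h T θ _ => .botL (Or.inl h), fun Γ h => by simpa using h ∅ bot (by simp)⟩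
  | and φ ψ ihφ ihψ =>
    refine ⟨fun Γ h => ?_, fun Γ h => .andR (ihφ.2 _ h.1) (ihψ.2 _ h.2)⟩
    have key : ∀ χ : Formula α, insert φ (insert ψ Γ) ∈ χ.val → Γ ∈ χ.val := fun χ hχ =>
      χ.contextClosed_val fun T θ hT => .andL (Or.inl h) (by simpa [Set.insert_union] using hT _ hχ)
    exact ⟨key φ (ihφ.1 _ (by simp)), key ψ (ihψ.1 _ (by simp))⟩
  | or φ ψ ihφ ihψ =>
    constructor
    · intro Γ h T θ hT
      refine .orL (Or.inl h) ?_ ?_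
      · simpa [Set.insert_union] using hT (insert φ Γ) (Or.inl (ihφ.1 _ (by simp)))
      · simpa [Set.insert_union] using hT (insert ψ Γ) (Or.inr (ihψ.1 _ (by simp)))
    · intro Γ h
      refine contextClosed_setDerivable _ (contextClosure_mono ?_ h)
      rintro R (hR | hR)
      · exact .orR₀ (ihφ.2 _ hR)
      · exact .orR₁ (ihψ.2 _ hR)
  | imp φ ψ ihφ ihψ =>
    constructor
    · intro Γ h Γ' hΓ hφ
      refine ψ.contextClosed_val fun T θ hT => .impL (Or.inl (hΓ h))
        ((ihφ.2 _ hφ).weaken Set.subset_union_left) ?_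
      simpa [Set.insert_union] using hT (insert ψ Γ') (ihψ.1 _ (by simp))
    · intro Γ h
      exact .impR (ihψ.2 _ (h _ (Set.subset_insert _ _) (ihφ.1 _ (by simp))))
  | box φ ihφ =>
    constructor
    · intro Γ h
      exact subset_contextClosure _ ⟨φ, h, ihφ.1 _ rfl⟩
    · intro Γ h
      refine contextClosed_setDerivable _ (contextClosure_mono ?_ h)
      rintro R ⟨χ, hχ, hφ⟩
      exact .mono hχ (ihφ.2 _ hφ)

/-- Semantic consequence in the model of contexts. -/
def Entails (Γ : Multiset (Formula α)) (θ : Formula α) : Prop :=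
  ∀ T : Set (Formula α), (∀ φ ∈ Γ, T ∈ φ.val) → T ∈ θ.val

/-- Consequence is evaluated at the context `Γ` itself, which satisfies all its members. -/
theorem Entails.setDerivable {Γ : Multiset (Formula α)} {θ : Formula α} (h : Entails Γ θ) :
    SetDerivable {φ | φ ∈ Γ} θ :=
  θ.mem_val_and_setDerivable.2 _ (h _ fun φ hφ => φ.mem_val_and_setDerivable.1 _ hφ)

theorem SetDerivable.derivable_G3iMw {Γ : Multiset (Formula α)} {θ : Formula α}
    (h : SetDerivable {φ | φ ∈ Γ} θ) : Derivable G3iMw ⟨Γ, some θ⟩ :=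
  h.toG3 fun _ => .mem

theorem Entails.cons_iff {Γ : Multiset (Formula α)} {φ θ : Formula α} :
    Entails (φ ::ₘ Γ) θ ↔
      ∀ T : Set (Formula α), T ∈ φ.val → (∀ χ ∈ Γ, T ∈ χ.val) → T ∈ θ.val := by
  simp [Entails]

theorem Entails.impR {Γ : Multiset (Formula α)} {φ ψ : Formula α} (h : Entails (φ ::ₘ Γ) ψ) :
    Entails Γ (imp φ ψ) :=
  fun _ hT T' hTT' hφ =>
    cons_iff.1 h T' hφ fun χ hχ => χ.contextClosed_val.upward (hT χ hχ) hTT'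

theorem Entails.of_imp {Γ : Multiset (Formula α)} {φ ψ : Formula α} (h : Entails Γ (imp φ ψ)) :
    Entails (φ ::ₘ Γ) ψ :=
  cons_iff.2 fun T hφ hT => h T hT T subset_rfl hφ

theorem Entails.orL {Γ : Multiset (Formula α)} {φ ψ θ : Formula α} (h₁ : Entails (φ ::ₘ Γ) θ)
    (h₂ : Entails (ψ ::ₘ Γ) θ) : Entails (Formula.or φ ψ ::ₘ Γ) θ :=
  cons_iff.2 fun T hT hΓ => val_or_elim hT (h₁.impR T hΓ) (h₂.impR T hΓ)

theorem Entails.mono {φ ψ : Formula α} (h : Entails {φ} ψ) : (box φ).val ⊆ (box ψ).val :=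
  val_box_mono fun T hT => h T (by simpa using hT)

/-- Replacing the head of the antecedent by a weaker formula. -/
theorem Entails.cons_of_subset {Γ : Multiset (Formula α)} {φ ψ θ : Formula α}
    (h : Entails (φ ::ₘ Γ) θ) (hφ : ψ.val ⊆ φ.val) : Entails (ψ ::ₘ Γ) θ :=
  cons_iff.2 fun T hT => cons_iff.1 h T (hφ hT)

theorem Formula.val_subset_imp (φ ψ : Formula α) : ψ.val ⊆ (imp φ ψ).val :=
  fun _ hT _ h _ => ψ.contextClosed_val.upward hT h

theorem Formula.val_imp_mp {φ ψ : Formula α} {T : Set (Formula α)} (h : T ∈ (imp φ ψ).val)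
    (hφ : T ∈ φ.val) : T ∈ ψ.val :=
  h T subset_rfl hφ

theorem Formula.val_and_imp (φ₁ φ₂ ψ : Formula α) :
    (imp (Formula.and φ₁ φ₂) ψ).val = (imp φ₁ (imp φ₂ ψ)).val := by
  ext T
  constructor
  · intro h U hU h₁ V hV h₂
    exact h V (hU.trans hV) ⟨φ₁.contextClosed_val.upward h₁ hV, h₂⟩
  · intro h U hU h₁
    exact h U hU h₁.1 U subset_rfl h₁.2

theorem Formula.val_or_imp (φ₁ φ₂ ψ : Formula α) :
    (imp (Formula.or φ₁ φ₂) ψ).val = (imp φ₁ ψ).val ∩ (imp φ₂ ψ).val := by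
  ext T
  constructor
  · intro h
    exact ⟨fun U hU h₁ => h U hU (subset_contextClosure _ (Or.inl h₁)),
      fun U hU h₁ => h U hU (subset_contextClosure _ (Or.inr h₁))⟩
  · rintro ⟨h₁, h₂⟩ U hU h
    exact val_or_elim h ((imp φ₁ ψ).contextClosed_val.upward h₁ hU)
      ((imp φ₂ ψ).contextClosed_val.upward h₂ hU)

/-- Validity of sequents; sequents with empty succedent count as invalid, as none is derivable. -/
def Sequent.Valid (S : Sequent α) : Prop :=
  ∃ θ, S.suc = some θ ∧ Entails S.ant θ

@[simp] theorem Sequent.valid_some {Γ : Multiset (Formula α)} {θ : Formula α} :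
    Sequent.Valid ⟨Γ, some θ⟩ ↔ Entails Γ θ := by
  simp [Sequent.Valid]

/-! ### Soundness of both calculi in the model of contexts -/

theorem Derivable.valid {C : Calculus α} (hC : ∀ Ps S, C Ps S → (∀ P ∈ Ps, P.Valid) → S.Valid)
    {S : Sequent α} (h : Derivable C S) : S.Valid := by
  induction h with
  | rule Ps S h _ ih => exact hC Ps S h ih

theorem G3iMw.valid {Ps : List (Sequent α)} {S : Sequent α} (h : G3iMw Ps S)
    (hPs : ∀ P ∈ Ps, P.Valid) : S.Valid := by
  cases h with
  | ax Γ p => simpa using Entails.cons_iff.2 fun T hT _ => hT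
  | botL Γ φ => simpa using Entails.cons_iff.2 fun T hT _ => φ.val_bot_subset hT
  | andL Γ φ ψ θ =>
    simp only [List.mem_singleton, forall_eq, Sequent.valid_some] at hPs ⊢
    refine Entails.cons_iff.2 fun T hT hΓ => hPs T ?_
    simpa using ⟨hT.1, hT.2, hΓ⟩
  | andR Γ φ ψ =>
    simp only [List.mem_cons, List.not_mem_nil, or_false, forall_eq_or_imp, forall_eq,
      Sequent.valid_some] at hPs ⊢
    exact fun T hT => ⟨hPs.1 T hT, hPs.2 T hT⟩
  | orL Γ φ ψ θ =>
    simp only [List.mem_cons, List.not_mem_nil, or_false, forall_eq_or_imp, forall_eq,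
      Sequent.valid_some] at hPs ⊢
    exact hPs.1.orL hPs.2
  | orR₀ Γ φ ψ =>
    simp only [List.mem_singleton, forall_eq, Sequent.valid_some] at hPs ⊢
    exact fun T hT => subset_contextClosure _ (Or.inl (hPs T hT))
  | orR₁ Γ φ ψ =>
    simp only [List.mem_singleton, forall_eq, Sequent.valid_some] at hPs ⊢
    exact fun T hT => subset_contextClosure _ (Or.inr (hPs T hT))
  | impL Γ φ ψ θ =>
    simp only [List.mem_cons, List.not_mem_nil, or_false, forall_eq_or_imp, forall_eq,
      Sequent.valid_some] at hPs ⊢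
    refine Entails.cons_iff.2 fun T hT hΓ => Entails.cons_iff.1 hPs.2 T (val_imp_mp hT ?_) hΓ
    exact Entails.cons_iff.1 hPs.1 T hT hΓ
  | impR Γ φ ψ =>
    simp only [List.mem_singleton, forall_eq, Sequent.valid_some] at hPs ⊢
    exact hPs.impR
  | mono Γ φ ψ =>
    simp only [List.mem_singleton, forall_eq, Sequent.valid_some] at hPs ⊢
    exact Entails.cons_iff.2 fun T hT _ => hPs.mono hT

theorem G4iM.valid {Ps : List (Sequent α)} {S : Sequent α} (h : G4iM Ps S)
    (hPs : ∀ P ∈ Ps, P.Valid) : S.Valid := by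
  rcases h with ⟨_, _, ⟨_, _, h⟩ | ⟨Γ, φ, Δ⟩ | ⟨Γ, φ⟩⟩ | ⟨φ, ψ⟩ | ⟨Γ, φ, ψ, θ, Δ⟩
  · cases h with
    | ax Γ p => exact G3iMw.valid (.ax Γ p) (by simp)
    | botL Γ φ => exact G3iMw.valid (.botL Γ φ) (by simp)
    | andL Γ φ ψ Δ =>
      obtain ⟨θ, rfl, -⟩ := hPs _ (List.mem_singleton_self _)
      exact G3iMw.valid (.andL Γ φ ψ θ) hPs
    | andR Γ φ ψ => exact G3iMw.valid (.andR Γ φ ψ) hPs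
    | orL Γ φ ψ Δ =>
      obtain ⟨θ, rfl, -⟩ := hPs _ List.mem_cons_self
      exact G3iMw.valid (.orL Γ φ ψ θ) hPs
    | orR₀ Γ φ ψ => exact G3iMw.valid (.orR₀ Γ φ ψ) hPs
    | orR₁ Γ φ ψ => exact G3iMw.valid (.orR₁ Γ φ ψ) hPs
    | impR Γ φ ψ => exact G3iMw.valid (.impR Γ φ ψ) hPs
    | atomImpL Γ p ψ Δ =>
      obtain ⟨θ, hθ, h⟩ := hPs _ (List.mem_singleton_self _)
      refine ⟨θ, hθ, fun T hT => h T ?_⟩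
      simp only [Multiset.mem_cons, forall_eq_or_imp] at hT ⊢
      exact ⟨hT.1, val_imp_mp hT.2.1 hT.1, hT.2.2⟩
    | andImpL Γ φ₁ φ₂ ψ Δ =>
      obtain ⟨θ, hθ, h⟩ := hPs _ (List.mem_singleton_self _)
      exact ⟨θ, hθ, h.cons_of_subset (val_and_imp φ₁ φ₂ ψ).subset⟩
    | orImpL Γ φ₁ φ₂ ψ Δ =>
      obtain ⟨θ, hθ, h⟩ := hPs _ (List.mem_singleton_self _)
      refine ⟨θ, hθ, fun T hT => h T ?_⟩
      simp only [Multiset.mem_cons, forall_eq_or_imp] at hT ⊢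
      have := (val_or_imp φ₁ φ₂ ψ).subset hT.1
      exact ⟨this.1, this.2, hT.2⟩
    | impImpL Γ φ₁ φ₂ ψ Δ =>
      simp only [List.mem_cons, List.not_mem_nil, or_false, forall_eq_or_imp, forall_eq,
        Sequent.valid_some] at hPs
      obtain ⟨h₁, θ, hθ, h₂⟩ := hPs
      refine ⟨θ, hθ, Entails.cons_iff.2 fun T hT hΓ =>
        Entails.cons_iff.1 h₂ T (val_imp_mp hT (Entails.cons_iff.1 h₁ T ?_ hΓ)) hΓ⟩
      -- `(φ₁ → φ₂) → ψ` entails `φ₂ → ψ`, because `φ₂` entails `φ₁ → φ₂`.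
      exact fun U hU h => hT U hU (φ₁.val_subset_imp φ₂ h)
  · obtain ⟨θ, hθ, h⟩ := hPs _ (List.mem_singleton_self _)
    exact ⟨θ, hθ, Entails.cons_iff.2 fun T _ hT => h T hT⟩
  -- Right weakening is vacuous: its premise has empty succedent and is never valid.
  · obtain ⟨θ, hθ, -⟩ := hPs _ (List.mem_singleton_self _)
    simp at hθ
  · exact G3iMw.valid (.mono 0 φ ψ) hPs
  · simp only [List.mem_cons, List.not_mem_nil, or_false, forall_eq_or_imp, forall_eq,
      Sequent.valid_some] at hPs
    obtain ⟨h₁, χ, hχ, h₂⟩ := hPs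
    refine ⟨χ, hχ, fun T hT => h₂ T ?_⟩
    simp only [Multiset.mem_cons, forall_eq_or_imp] at hT ⊢
    exact ⟨hT.1, val_imp_mp hT.2.1 (h₁.mono hT.1), hT.2.2⟩

theorem Entails.derivable_G3iMw {Γ : Multiset (Formula α)} {θ : Formula α} (h : Entails Γ θ) :
    Derivable G3iMw ⟨Γ, some θ⟩ :=
  h.setDerivable.derivable_G3iMw

theorem derivable_G3iMw_iff_valid {S : Sequent α} : Derivable G3iMw S ↔ S.Valid := by
  refine ⟨Derivable.valid fun _ _ => G3iMw.valid, ?_⟩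
  obtain ⟨Γ, Δ⟩ := S
  rintro ⟨θ, rfl, h⟩
  exact h.derivable_G3iMw

/-- Soundness of the set calculus is borrowed from `G3iM^w` through the translation. It turns the
premises of a set derivation back into valid sequents. -/
theorem SetDerivable.entails {Γ : Multiset (Formula α)} {θ : Formula α}
    (h : SetDerivable {φ | φ ∈ Γ} θ) : Entails Γ θ :=
  Sequent.valid_some.1 (derivable_G3iMw_iff_valid.1 h.derivable_G3iMw)

/-! ### Completeness of `G4iM` -/

/-- A rule instance of `G4iM` with valid premises, where smaller valid sequents are derivable. -/
theorem G4iM.derivable_of_valid_premises {Ps : List (Sequent α)} {S : Sequent α} (h : G4iM Ps S)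
    (ih : ∀ P : Sequent α, P.cost < S.cost → P.Valid → Derivable G4iM P)
    (hPs : ∀ P ∈ Ps, P.Valid) : Derivable G4iM S :=
  .rule Ps S h fun P hP => ih P (h.cost_lt P hP) (hPs P hP)

/-- No formula of `Γ` is the principal formula of an invertible left rule of `G4iM` whose
principal formula is unique, and `⊥` is not in `Γ`. -/
structure Irreducible (Γ : Multiset (Formula α)) : Prop where
  bot : bot ∉ Γ
  and : ∀ φ ψ, Formula.and φ ψ ∉ Γ
  or : ∀ φ ψ, Formula.or φ ψ ∉ Γ
  and_imp : ∀ φ₁ φ₂ ψ, imp (Formula.and φ₁ φ₂) ψ ∉ Γ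
  or_imp : ∀ φ₁ φ₂ ψ, imp (Formula.or φ₁ φ₂) ψ ∉ Γ

/-- The rules for the excluded shapes preserve validity from conclusion to premises, so each may be
applied backwards to cheaper sequents; `⊥` gives an axiom. -/
theorem Entails.derivable_of_not_irreducible {Γ : Multiset (Formula α)} {θ : Formula α}
    (h : Entails Γ θ)
    (ih : ∀ P : Sequent α, P.cost < Sequent.cost ⟨Γ, some θ⟩ → P.Valid → Derivable G4iM P)
    (hΓ : ¬ Irreducible Γ) : Derivable G4iM ⟨Γ, some θ⟩ := by
  by_contra hn
  refine hΓ ⟨?_, ?_, ?_, ?_, ?_⟩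
  · intro hmem
    obtain ⟨Γ, rfl⟩ := Multiset.exists_cons_of_mem hmem
    exact hn (.rule _ _ (.ofG4w _ _ (.ofG4ip _ _ (.botL Γ θ))) (by simp))
  · intro φ ψ hmem
    obtain ⟨Γ, rfl⟩ := Multiset.exists_cons_of_mem hmem
    refine hn (G4iM.derivable_of_valid_premises (.ofG4w _ _ (.ofG4ip _ _ (.andL Γ φ ψ _))) ih ?_)
    simp only [List.mem_singleton, forall_eq, Sequent.valid_some]
    refine fun T hT => h T ?_
    simp only [Multiset.mem_cons, forall_eq_or_imp] at hT ⊢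
    exact ⟨⟨hT.1, hT.2.1⟩, hT.2.2⟩
  · intro φ ψ hmem
    obtain ⟨Γ, rfl⟩ := Multiset.exists_cons_of_mem hmem
    refine hn (G4iM.derivable_of_valid_premises (.ofG4w _ _ (.ofG4ip _ _ (.orL Γ φ ψ _))) ih ?_)
    simp only [List.mem_cons, List.not_mem_nil, or_false, forall_eq_or_imp, forall_eq,
      Sequent.valid_some]
    exact ⟨h.cons_of_subset fun T hT => subset_contextClosure _ (Or.inl hT),
      h.cons_of_subset fun T hT => subset_contextClosure _ (Or.inr hT)⟩
  · intro φ₁ φ₂ ψ hmem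
    obtain ⟨Γ, rfl⟩ := Multiset.exists_cons_of_mem hmem
    refine hn (G4iM.derivable_of_valid_premises
      (.ofG4w _ _ (.ofG4ip _ _ (.andImpL Γ φ₁ φ₂ ψ _))) ih ?_)
    simp only [List.mem_singleton, forall_eq, Sequent.valid_some]
    exact h.cons_of_subset (val_and_imp φ₁ φ₂ ψ).symm.subset
  · intro φ₁ φ₂ ψ hmem
    obtain ⟨Γ, rfl⟩ := Multiset.exists_cons_of_mem hmem
    refine hn (G4iM.derivable_of_valid_premises
      (.ofG4w _ _ (.ofG4ip _ _ (.orImpL Γ φ₁ φ₂ ψ _))) ih ?_)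
    simp only [List.mem_singleton, forall_eq, Sequent.valid_some]
    refine fun T hT => h T ?_
    simp only [Multiset.mem_cons, forall_eq_or_imp] at hT ⊢
    exact ⟨(val_or_imp φ₁ φ₂ ψ).symm.subset ⟨hT.1, hT.2.1⟩, hT.2.2⟩

/-- If an implication in `Γ` has an antecedent that is derivable from `Γ`, then some left rule of
`G4iM` for implications applies backwards. The induction follows the derivation of the antecedent
to an implication whose antecedent is obtained by an axiom or a right rule. -/
theorem Entails.derivable_of_imp_mem {Γ : Multiset (Formula α)} {θ : Formula α}
    (h : Entails Γ θ)
    (ih : ∀ P : Sequent α, P.cost < Sequent.cost ⟨Γ, some θ⟩ → P.Valid → Derivable G4iM P)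
    (hΓ : Irreducible Γ) {Δ : Set (Formula α)} {δ : Formula α} (hδ : SetDerivable Δ δ) :
    Δ = {φ | φ ∈ Γ} → ∀ ψ, imp δ ψ ∈ Γ → Derivable G4iM ⟨Γ, some θ⟩ := by
  induction hδ with
  | @ax _ p hp =>
    rintro rfl ψ hψ
    obtain ⟨Γ', rfl⟩ := Multiset.exists_cons_of_mem hp
    obtain ⟨Γ, rfl⟩ := Multiset.exists_cons_of_mem
      ((Multiset.mem_cons.1 hψ).resolve_left (by simp))
    refine G4iM.derivable_of_valid_premises (.ofG4w _ _ (.ofG4ip _ _ (.atomImpL Γ p ψ _))) ih ?_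
    simp only [List.mem_singleton, forall_eq, Sequent.valid_some]
    refine fun T hT => h T ?_
    simp only [Multiset.mem_cons, forall_eq_or_imp] at hT ⊢
    exact ⟨hT.1, val_subset_imp _ _ hT.2.1, hT.2.2⟩
  | botL hb => rintro rfl; exact absurd hb hΓ.bot
  | andL hmem => rintro rfl; exact absurd hmem (hΓ.and _ _)
  | orL hmem => rintro rfl; exact absurd hmem (hΓ.or _ _)
  | andR => intro _ ψ hψ; exact absurd hψ (hΓ.and_imp _ _ _)
  | orR₀ => intro _ ψ hψ; exact absurd hψ (hΓ.or_imp _ _ _)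
  | orR₁ => intro _ ψ hψ; exact absurd hψ (hΓ.or_imp _ _ _)
  -- The antecedent was itself obtained from an implication of `Γ`. Attention moves to that
  -- implication, whose antecedent has a shorter derivation from the same `Γ`.
  | impL hmem _ _ ih₁ _ => rintro rfl _ _; exact ih₁ rfl _ hmem
  | @impR _ φ₁ φ₂ hd _ =>
    rintro rfl ψ hψ
    have hδ : Entails Γ (imp φ₁ φ₂) := hd.impR.entails
    obtain ⟨Γ, rfl⟩ := Multiset.exists_cons_of_mem hψ
    refine G4iM.derivable_of_valid_premises
      (.ofG4w _ _ (.ofG4ip _ _ (.impImpL Γ φ₁ φ₂ ψ _))) ih ?_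
    simp only [List.mem_cons, List.not_mem_nil, or_false, forall_eq_or_imp, forall_eq,
      Sequent.valid_some]
    refine ⟨Entails.impR ?_, h.cons_of_subset (val_subset_imp _ _)⟩
    intro T hT
    simp only [Multiset.mem_cons, forall_eq_or_imp] at hT
    obtain ⟨h₁, h₂, hΓT⟩ := hT
    -- Given `φ₁` and `φ₂ → ψ`, any extension satisfying `φ₁ → φ₂` satisfies `φ₂`, hence `ψ`. So the
    -- removed formula `(φ₁ → φ₂) → ψ` holds at `T`, and `hδ` applies.
    refine val_imp_mp (Entails.cons_iff.1 hδ T (fun U hU hU' => ?_) hΓT) h₁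
    exact h₂ U hU (val_imp_mp hU' (φ₁.contextClosed_val.upward h₁ hU))
  | @mono _ φ χ hmem hd _ =>
    rintro rfl ψ hψ
    obtain ⟨Γ', rfl⟩ := Multiset.exists_cons_of_mem hmem
    obtain ⟨Γ, rfl⟩ := Multiset.exists_cons_of_mem
      ((Multiset.mem_cons.1 hψ).resolve_left (by simp))
    refine G4iM.derivable_of_valid_premises (.boxImpL Γ φ χ ψ _) ih ?_
    simp only [List.mem_cons, List.not_mem_nil, or_false, forall_eq_or_imp, forall_eq,
      Sequent.valid_some]
    refine ⟨SetDerivable.entails (by simpa using hd), fun T hT => h T ?_⟩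
    simp only [Multiset.mem_cons, forall_eq_or_imp] at hT ⊢
    exact ⟨hT.1, val_subset_imp _ _ hT.2.1, hT.2.2⟩

theorem Derivable.G4iM_weaken {Γ : Multiset (Formula α)} {Δ : Option (Formula α)}
    (h : Derivable G4iM ⟨Γ, Δ⟩) (Γ' : Multiset (Formula α)) : Derivable G4iM ⟨Γ' + Γ, Δ⟩ := by
  induction Γ' using Multiset.induction with
  | empty => simpa using h
  | cons φ Γ' ih =>
    rw [Multiset.cons_add]
    exact .rule _ _ (.ofG4w _ _ (.weakL _ φ Δ)) (by simpa using ih)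

/-- The set derivation serves only to select a rule by its last step; the recursion is on cost, and
premises are passed on as valid sequents. For irreducible `Γ` the only possible last left rule is
the one for implication. -/
theorem Sequent.Valid.derivable_G4iM {S : Sequent α} (hS : S.Valid) : Derivable G4iM S := by
  induction hn : S.cost using Nat.strong_induction_on generalizing S with
  | _ n ih =>
  subst hn
  replace ih : ∀ P : Sequent α, P.cost < S.cost → P.Valid → Derivable G4iM P :=
    fun P hP hv => ih _ hP hv rfl
  obtain ⟨Γ, Δ⟩ := S
  obtain ⟨θ, rfl, h⟩ := hS
  dsimp only at h
  by_cases hΓ : Irreducible Γ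
  swap
  · exact h.derivable_of_not_irreducible ih hΓ
  have hd := h.setDerivable
  generalize hΔ : {φ | φ ∈ Γ} = Δ at hd
  cases hd with
  | @ax _ p hp =>
    subst hΔ
    obtain ⟨Γ, rfl⟩ := Multiset.exists_cons_of_mem hp
    exact .rule _ _ (.ofG4w _ _ (.ofG4ip _ _ (.ax Γ p))) (by simp)
  | botL hb => subst hΔ; exact absurd hb hΓ.bot
  | andL hmem => subst hΔ; exact absurd hmem (hΓ.and _ _)
  | orL hmem => subst hΔ; exact absurd hmem (hΓ.or _ _)
  | @andR _ φ ψ h₁ h₂ =>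
    subst hΔ
    refine G4iM.derivable_of_valid_premises (.ofG4w _ _ (.ofG4ip _ _ (.andR Γ φ ψ))) ih ?_
    simpa using ⟨h₁.entails, h₂.entails⟩
  | @orR₀ _ φ ψ h₁ =>
    subst hΔ
    refine G4iM.derivable_of_valid_premises (.ofG4w _ _ (.ofG4ip _ _ (.orR₀ Γ φ ψ))) ih ?_
    simpa using h₁.entails
  | @orR₁ _ φ ψ h₁ =>
    subst hΔ
    refine G4iM.derivable_of_valid_premises (.ofG4w _ _ (.ofG4ip _ _ (.orR₁ Γ φ ψ))) ih ?_
    simpa using h₁.entails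
  | impL hmem h₁ _ =>
    subst hΔ
    exact h.derivable_of_imp_mem ih hΓ h₁ rfl _ hmem
  | @impR _ φ ψ h₁ =>
    refine G4iM.derivable_of_valid_premises (.ofG4w _ _ (.ofG4ip _ _ (.impR Γ φ ψ))) ih ?_
    simpa using h.of_imp
  | @mono _ φ ψ hmem h₁ =>
    subst hΔ
    obtain ⟨Γ, rfl⟩ := Multiset.exists_cons_of_mem hmem
    -- The rule for `□` in `G4iM` has no context, so costs are compared through `{□φ} ⇒ □ψ`, and the
    -- rest of `Γ` is restored by left weakening.
    have hcost : (⟨{φ}, some ψ⟩ : Sequent α).cost < (⟨{box φ}, some (box ψ)⟩ : Sequent α).cost :=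
      (G4iM.mono φ ψ).cost_lt _ (by simp)
    have hle : (⟨{box φ}, some (box ψ)⟩ : Sequent α).cost
        ≤ (⟨box φ ::ₘ Γ, some (box ψ)⟩ : Sequent α).cost := by
      simp [Sequent.cost]
    have hbox : Derivable G4iM ⟨{box φ}, some (box ψ)⟩ := by
      refine .rule _ _ (.mono φ ψ) ?_
      simp only [List.mem_singleton, forall_eq]
      exact ih _ (hcost.trans_le hle) (by simpa using SetDerivable.entails (by simpa using h₁))
    rw [← Multiset.singleton_add, add_comm]
    exact hbox.G4iM_weaken Γ

theorem derivable_G4iM_iff_valid {S : Sequent α} : Derivable G4iM S ↔ S.Valid :=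
  ⟨Derivable.valid fun _ _ => G4iM.valid, Sequent.Valid.derivable_G4iM⟩

theorem derivable_G3iMw_iff_derivable_G4iM {S : Sequent α} :
    Derivable G3iMw S ↔ Derivable G4iM S :=
  derivable_G3iMw_iff_valid.trans derivable_G4iM_iff_valid.symm

end IMLogic

theorem mainTheorem3 (α : Type*) :
    (∀ S : IMLogic.Sequent α,
      IMLogic.Derivable IMLogic.G3iMw S ↔ IMLogic.Derivable IMLogic.G4iM S) ∧
    IMLogic.iM α = IMLogic.logicOf IMLogic.G4iM ∧
    IMLogic.IsTerminating (IMLogic.G4iM (α := α)) ∧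
    (¬ ∃ G : ℕ → Multiset (IMLogic.Sequent α),
      ∀ n, IMLogic.SearchStep IMLogic.G4iM (G n) (G (n + 1))) := by
  refine ⟨fun S => IMLogic.derivable_G3iMw_iff_derivable_G4iM, ?_,
    IMLogic.G4iM.isTerminating, IMLogic.G4iM.isTerminating.no_infinite_search⟩
  ext φ
  exact IMLogic.derivable_G3iMw_iff_derivable_G4iM
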